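/- Let $k$ be a field of characteristic zero and $R=k[x_1,\dots,x_r]$. Let $A=R/I$ be a graded artinian quotient of $R$, where $I$ is a homogeneous ideal containing no non-zero form of degree $1$. Its $h$-vector is $h=(h_0,\dots,h_e)$, where $h_i=\dim_k A_i$ and $e$ (the socle degree) is the last index with $h_e>0$; thus $h_0=1$, and if $e\ge 1$ then $h_1=r$. The socle of $A$ is $\operatorname{soc}(A)=\{u\in A : u\bar x_1=\dots=u\bar x_r=0\}$, and $A$ is level of type $t$ if $\operatorname{soc}(A)_i=0$ for $i<e$ and $\dim_k\operatorname{soc}(A)_e=t$ (so that $h_e=t$). A level $h$-vector of type $2$ and codimension $r$ is the $h$-vector of such an algebra $A$ that is level of type $2$. (i) If $h=(1,r,\dots,a,2)$ is a level $h$-vector of type $2$ and codimension $r$, with socle degree $e\ge 2$ and $a=h_{e-1}$, then $a\le 2r$. Moreover, for all integers $r\ge 2$, $e\ge 3$ and $a\in[r,2r]$ with $(r,e,a)\ne(2,3,4)$, there is a level $h$-vector $h=(1,r,\dots,a,2)$ over $k$ of type $2$, codimension $r$ and socle degree $e$ with $h_{e-1}=a$. (The triple $(2,3,4)$ has to be left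 out, since $h_2\le 3$ when $r=2$.) (ii) If $h=(1,r,\dots,a,2)$ is a level $h$-vector of type $2$ and codimension $r$, with socle degree $e\ge 2$ and $a=h_{e-1}$, and if $r\le 7$, then $a\ge r$. -/

import Mathlib

open MvPolynomial

namespace LevelAlgebra

noncomputable section

attribute [local instance] MvPolynomial.gradedAlgebra

/-- The degree `i` component `A_i` of `A = k[x_1, ..., x_r] / I`: the image of the space of forms of
degree `i`. -/
def component {k : Type*} [Field k] {r : ℕ} (I : Ideal (MvPolynomial (Fin r) k)) (i : ℕ) :
    Submodule k (MvPolynomial (Fin r) k ⧸ I) :=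
  (homogeneousSubmodule (Fin r) k i).map (Ideal.Quotient.mkₐ k I).toLinearMap

/-- The Hilbert function `i ↦ dim_k A_i` of `A = k[x_1, ..., x_r] / I`. -/
def hVector {k : Type*} [Field k] {r : ℕ} (I : Ideal (MvPolynomial (Fin r) k)) (i : ℕ) : ℕ :=
  Module.finrank k (component I i)

/-- The socle of `A = k[x_1, ..., x_r] / I`: the annihilator of the ideal of `A` generated by the
classes of the variables. -/
def socle {k : Type*} [Field k] {r : ℕ} (I : Ideal (MvPolynomial (Fin r) k)) :
    Ideal (MvPolynomial (Fin r) k ⧸ I) :=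
  Submodule.annihilator
    (Ideal.span (Set.range fun j : Fin r => Ideal.Quotient.mk I (X j)))

/-- The socle-vector of `A = k[x_1, ..., x_r] / I`: `i ↦ dim_k soc(A)_i`. -/
def socleVector {k : Type*} [Field k] {r : ℕ} (I : Ideal (MvPolynomial (Fin r) k)) (i : ℕ) : ℕ :=
  Module.finrank k ↥((socle I).restrictScalars k ⊓ component I i)

/-- `A = k[x_1, ..., x_r] / I` is a standard graded artinian level algebra of codimension `r`,
socle degree `e` and type `t`. -/
structure IsLevelAlgebra {k : Type*} [Field k] {r : ℕ} (I : Ideal (MvPolynomial (Fin r) k))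
    (e t : ℕ) : Prop where
  homogeneous : I.IsHomogeneous (homogeneousSubmodule (Fin r) k)
  artinian : IsArtinianRing (MvPolynomial (Fin r) k ⧸ I)
  no_linear_form : ∀ f ∈ I, f.IsHomogeneous 1 → f = 0
  socle_degree : IsGreatest {i | 0 < hVector I i} e
  socle_below : ∀ i < e, socleVector I i = 0
  socle_top : socleVector I e = t

/-- `h` (extended by zero beyond degree `e`) is the `h`-vector of a level algebra over `k` of
codimension `r`, socle degree `e` and type `t`. -/
def IsLevelHVector (k : Type*) [Field k] (r e t : ℕ) (h : ℕ → ℕ) : Prop :=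
  ∃ I : Ideal (MvPolynomial (Fin r) k), IsLevelAlgebra I e t ∧ hVector I = h

end

end LevelAlgebra

/-!
*Upper bound.* Since `A` has no socle in degree `e - 1`, multiplication embeds `A_{e-1}` into
`Hom(A_1, A_e)`.

*Lower bound.* Let `p, q` be functionals separating the points of the plane `A_e`, and let
`K_p ⊆ A_1` and `Z_p ⊆ A_{e-1}` be the radicals of the pairing `(x, y) ↦ p (x * y)` of `A_1` with
`A_{e-1}`, so that `r - dim K_p = a - dim Z_p`. A product of elements of `K_p` and `K_q` is killed
by both functionals against `A_{e-2}`, hence `K_p * K_q = 0`. In the same way an element of `A_1`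
whose products with `Z_p` are killed by `q` annihilates `K_p`, so `ann K_p` has codimension at most
`dim Z_p` in `A_1`. Suppose `a < r`, that is `dim Z_p < dim K_p`. If `ann K_p` had codimension at
most one, say `A_1 = ann K_p + k z`, then `x ↦ q (x * z ^ (e - 1))` would be injective on `K_p`;
so `dim K_p = 1` and `Z_p = 0`, but `K_p * A_{e-2} ⊆ Z_p` then forces `K_p = 0`. Thus `ann K_p` has
codimension at least two, `dim Z_p ≥ 2`, and the same holds for `q` and `p + q`. Since `K_q` and
`K_{p+q}` are independent subspaces of `ann K_p`, we get `2 * (r - a + 2) ≤ r - 2`.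

*Existence.* Take the algebra apolar, under contraction, to `∑ i, x_i ^ e` and
`x_0 ^ e + ∑ i ∈ S, x_i ^ (e - 1) * x_{i+1}` with cyclic indices and `a - r` elements in `S`. The
contractions of the first form by the variables are all the `x_j ^ (e - 1)`, and modulo these the
second form contributes the monomials `x_i ^ (e - 2) * x_{i+1}`, `i ∈ S`.
-/

namespace LevelAlgebra

section Pairing

open Module

variable {k : Type*} [Field k]

theorem finrank_range_flip {V W : Type*} [AddCommGroup V] [Module k V] [AddCommGroup W]
    [Module k W] [FiniteDimensional k W] (B : V →ₗ[k] W →ₗ[k] k) :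
    finrank k (LinearMap.range B.flip) = finrank k (LinearMap.range B) := by
  have hflip : B.flip = B.dualMap ∘ₗ (evalEquiv k W).toLinearMap := rfl
  rw [hflip, LinearMap.range_comp_of_range_eq_top _ (LinearEquiv.range _)]
  exact LinearMap.finrank_range_dualMap_eq_finrank_range B

theorem exists_le_sup_span_singleton {E : Type*} [AddCommGroup E] [Module k E]
    {N V : Submodule k E} [FiniteDimensional k V] (hNV : N ≤ V)
    (h : finrank k V ≤ finrank k N + 1) : ∃ z ∈ V, V ≤ N ⊔ Submodule.span k {z} := by
  by_cases hVN : V ≤ N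
  · exact ⟨0, zero_mem V, hVN.trans le_sup_left⟩
  obtain ⟨z, hzV, hzN⟩ := SetLike.not_le_iff_exists.1 hVN
  have hle : N ⊔ Submodule.span k {z} ≤ V :=
    sup_le hNV ((Submodule.span_singleton_le_iff_mem z V).2 hzV)
  have := Submodule.finiteDimensional_of_le hle
  have hlt : N < N ⊔ Submodule.span k {z} :=
    left_lt_sup.2 fun hz => hzN ((Submodule.span_singleton_le_iff_mem z N).1 hz)
  have hrank := Submodule.finrank_lt_finrank_of_lt hlt
  exact ⟨z, hzV, (Submodule.eq_of_le_of_finrank_le hle (by omega)).ge⟩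

variable {A M : Type*} [CommRing A] [Algebra k A] [AddCommGroup M] [Module k M]

/-- The pairing `V × W → M`, `(x, y) ↦ p (x * y)`, of two subspaces of an algebra. -/
def pairing (p : A →ₗ[k] M) (V W : Submodule k A) : V →ₗ[k] W →ₗ[k] M :=
  ((LinearMap.mul k A).compr₂ p).domRestrict₁₂ V W

/-- The left radical of `pairing p V W`, as a subspace of the algebra. For `p = LinearMap.id` it is
the annihilator of `W` in `V`. -/
def leftRadical (p : A →ₗ[k] M) (V W : Submodule k A) : Submodule k A :=
  (LinearMap.ker (pairing p V W)).map V.subtype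

theorem mem_leftRadical {p : A →ₗ[k] M} {V W : Submodule k A} {x : A} :
    x ∈ leftRadical p V W ↔ x ∈ V ∧ ∀ y ∈ W, p (x * y) = 0 := by
  simp [leftRadical, LinearMap.ext_iff, pairing, LinearMap.domRestrict₁₂_apply, and_comm]

theorem leftRadical_le (p : A →ₗ[k] M) (V W : Submodule k A) : leftRadical p V W ≤ V :=
  Submodule.map_subtype_le V _

instance (p : A →ₗ[k] M) (V W : Submodule k A) [FiniteDimensional k V] :
    FiniteDimensional k (leftRadical p V W) :=
  Submodule.finiteDimensional_of_le (leftRadical_le p V W)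

theorem finrank_range_pairing_add_finrank_leftRadical (p : A →ₗ[k] M) (V W : Submodule k A)
    [FiniteDimensional k V] :
    finrank k (LinearMap.range (pairing p V W)) + finrank k (leftRadical p V W) = finrank k V := by
  rw [leftRadical, Submodule.finrank_map_subtype_eq]
  exact (pairing p V W).finrank_range_add_finrank_ker

theorem flip_pairing (p : A →ₗ[k] M) (V W : Submodule k A) :
    (pairing p V W).flip = pairing p W V :=
  LinearMap.ext₂ fun x y => congrArg p (mul_comm (y : A) x)

theorem finrank_add_finrank_leftRadical_comm (p : A →ₗ[k] k) (V W : Submodule k A)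
    [FiniteDimensional k V] [FiniteDimensional k W] :
    finrank k V + finrank k (leftRadical p W V) = finrank k W + finrank k (leftRadical p V W) := by
  have hV := finrank_range_pairing_add_finrank_leftRadical p V W
  have hW := finrank_range_pairing_add_finrank_leftRadical p W V
  rw [← flip_pairing, finrank_range_flip] at hW
  omega

/-- The functionals `p` and `q` have no common zero on `V` other than `0`. -/
def Separates (p q : A →ₗ[k] k) (V : Submodule k A) : Prop :=
  ∀ x ∈ V, p x = 0 → q x = 0 → x = 0

namespace Separates

variable {p q : A →ₗ[k] k} {V : Submodule k A}

theorem symm (h : Separates p q V) : Separates q p V :=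
  fun x hx hq hp => h x hx hp hq

theorem add_right (h : Separates p q V) : Separates p (p + q) V :=
  fun x hx hp hpq => h x hx hp (by simpa [hp] using hpq)

end Separates

theorem exists_separates {V : Submodule k A} (h : finrank k V = 2) :
    ∃ p q : A →ₗ[k] k, Separates p q V := by
  have : FiniteDimensional k V := FiniteDimensional.of_finrank_pos (by omega)
  let b := finBasisOfFinrankEq k V h
  obtain ⟨p, hp⟩ := (b.coord 0).exists_extend
  obtain ⟨q, hq⟩ := (b.coord 1).exists_extend
  refine ⟨p, q, fun x hx hpx hqx => ?_⟩
  have hcoord : ∀ i, b.coord i ⟨x, hx⟩ = 0 :=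
    Fin.forall_fin_two.2 ⟨hp ▸ hpx, hq ▸ hqx⟩
  exact congrArg Subtype.val (b.forall_coord_eq_zero_iff.1 hcoord)

end Pairing

section Level

open Module

variable {k A : Type*} [Field k] [CommRing A] [Algebra k A]

/-- The family `C`, thought of as the graded pieces of a standard graded algebra, has no socle in
degrees below `e`. -/
def NoSocleBelow (C : ℕ → Submodule k A) (e : ℕ) : Prop :=
  ∀ ⦃i : ℕ⦄, i < e → ∀ u ∈ C i, (∀ l ∈ C 1, u * l = 0) → u = 0

variable {C : ℕ → Submodule k A} [SetLike.GradedMonoid C] {e : ℕ}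

theorem mul_mem_leftRadical {p : A →ₗ[k] k} {i j l m n : ℕ} (hm : j + l = m) (hn : i + j = n)
    {x y : A} (hx : x ∈ leftRadical p (C i) (C m)) (hy : y ∈ C j) :
    x * y ∈ leftRadical p (C n) (C l) := by
  subst hm hn
  rw [mem_leftRadical] at hx ⊢
  refine ⟨SetLike.mul_mem_graded hx.1 hy, fun z hz => ?_⟩
  rw [mul_assoc]
  exact hx.2 _ (SetLike.mul_mem_graded hy hz)

namespace NoSocleBelow

theorem eq_zero_of_forall_mul_eq_zero (hC : NoSocleBelow C e) {i j : ℕ} (hij : i + j ≤ e) {u : A}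
    (hu : u ∈ C i) (h : ∀ t ∈ C j, u * t = 0) : u = 0 := by
  induction j generalizing i u with
  | zero => simpa using h 1 (SetLike.one_mem_graded C)
  | succ j ih =>
    refine hC (by omega) u hu fun l hl => ?_
    refine ih (i := i + 1) (by omega) (SetLike.mul_mem_graded hu hl) fun t ht => ?_
    rw [mul_assoc, mul_comm l]
    exact h _ (SetLike.mul_mem_graded ht hl)

theorem finrank_le_mul (hC : NoSocleBelow C e) {i : ℕ} (hi : i < e) [FiniteDimensional k (C 1)]
    [FiniteDimensional k (C (i + 1))] :
    finrank k (C i) ≤ finrank k (C 1) * finrank k (C (i + 1)) := by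
  let B : C i →ₗ[k] C 1 →ₗ[k] C (i + 1) :=
    LinearMap.mk₂ k (fun x y => ⟨x * y, SetLike.mul_mem_graded x.2 y.2⟩)
      (fun x x' y => by ext; simp [add_mul]) (fun c x y => by ext; simp)
      (fun x y y' => by ext; simp [mul_add]) (fun c x y => by ext; simp)
  have hB : Function.Injective B := (injective_iff_map_eq_zero B).2 fun x hx =>
    Subtype.ext (hC hi x x.2 fun l hl =>
      congrArg Subtype.val (DFunLike.congr_fun hx (⟨l, hl⟩ : C 1)))
  rw [← finrank_linearMap k k]
  exact LinearMap.finrank_le_finrank_of_injective hB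

variable {p q : A →ₗ[k] k}

theorem disjoint_leftRadical (hC : NoSocleBelow C e) (hpq : Separates p q (C e)) {i j : ℕ}
    (hij : i + j = e) :
    Disjoint (leftRadical p (C i) (C j)) (leftRadical q (C i) (C j)) := by
  subst hij
  refine Submodule.disjoint_def.2 fun x hxp hxq => ?_
  rw [mem_leftRadical] at hxp hxq
  exact hC.eq_zero_of_forall_mul_eq_zero le_rfl hxp.1 fun y hy =>
    hpq _ (SetLike.mul_mem_graded hxp.1 hy) (hxp.2 y hy) (hxq.2 y hy)

theorem leftRadical_le_annihilator (hC : NoSocleBelow C (e + 2))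
    (hpq : Separates p q (C (e + 2))) :
    leftRadical q (C 1) (C (e + 1)) ≤
      leftRadical LinearMap.id (C 1) (leftRadical p (C 1) (C (e + 1))) := by
  refine fun l hl => mem_leftRadical.2 ⟨leftRadical_le _ _ _ hl, fun m hm => ?_⟩
  refine Submodule.disjoint_def.1 (hC.disjoint_leftRadical hpq (add_comm 2 e)) _ ?_ ?_
  · rw [LinearMap.id_apply, mul_comm]
    exact mul_mem_leftRadical (add_comm 1 e) rfl hm (leftRadical_le _ _ _ hl)
  · exact mul_mem_leftRadical (add_comm 1 e) rfl hl (leftRadical_le _ _ _ hm)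

theorem leftRadical_leftRadical_le_annihilator (hC : NoSocleBelow C (e + 2))
    (hpq : Separates p q (C (e + 2))) :
    leftRadical q (C 1) (leftRadical p (C (e + 1)) (C 1)) ≤
      leftRadical LinearMap.id (C 1) (leftRadical p (C 1) (C (e + 1))) := by
  refine fun l hl => mem_leftRadical.2 ⟨leftRadical_le _ _ _ hl, fun m hm => ?_⟩
  have hlC := leftRadical_le _ _ _ hl
  have hmC := leftRadical_le _ _ _ hm
  refine Submodule.disjoint_def.1 (hC.disjoint_leftRadical hpq (add_comm 2 e)) _ ?_ ?_
  · rw [LinearMap.id_apply, mul_comm]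
    exact mul_mem_leftRadical (add_comm 1 e) rfl hm hlC
  · refine mem_leftRadical.2 ⟨SetLike.mul_mem_graded hlC hmC, fun t ht => ?_⟩
    rw [LinearMap.id_apply, mul_assoc]
    exact (mem_leftRadical.1 hl).2 _ (mul_mem_leftRadical rfl (add_comm 1 e) hm ht)

theorem finrank_le_finrank_annihilator_add (hC : NoSocleBelow C (e + 2))
    (hpq : Separates p q (C (e + 2))) [FiniteDimensional k (C 1)]
    [FiniteDimensional k (C (e + 1))] :
    finrank k (C 1) ≤
      finrank k (leftRadical LinearMap.id (C 1) (leftRadical p (C 1) (C (e + 1)))) +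
        finrank k (leftRadical p (C (e + 1)) (C 1)) := by
  have hrank :=
    finrank_add_finrank_leftRadical_comm q (C 1) (leftRadical p (C (e + 1)) (C 1))
  have hle := Submodule.finrank_mono (hC.leftRadical_leftRadical_le_annihilator hpq)
  omega

theorem eq_zero_of_mul_pow_eq_zero (hC : NoSocleBelow C e) {K : Submodule k A} {z : A}
    (hz : z ∈ C 1)
    (hspan : C 1 ≤ leftRadical LinearMap.id (C 1) K ⊔ Submodule.span k {z}) {m : A} {i j : ℕ}
    (hij : i + j ≤ e) (hmC : m ∈ C i) (hmK : m ∈ K) (h : m * z ^ j = 0) : m = 0 := by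
  induction j with
  | zero => simpa using h
  | succ j ih =>
    have hpow : z ^ j ∈ C j := by simpa using SetLike.pow_mem_graded j hz
    refine ih (by omega) (hC (by omega) _ (SetLike.mul_mem_graded hmC hpow) fun l hl => ?_)
    obtain ⟨x, hx, y, hy, rfl⟩ := Submodule.mem_sup.1 (hspan hl)
    obtain ⟨c, rfl⟩ := Submodule.mem_span_singleton.1 hy
    have hmx : x * m = 0 := (mem_leftRadical.1 hx).2 m hmK
    calc m * z ^ j * (x + c • z) = z ^ j * (x * m) + c • (m * z ^ (j + 1)) := by
          rw [mul_add, mul_smul_comm]; ring_nf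
      _ = 0 := by rw [hmx, h, mul_zero, smul_zero, add_zero]

theorem finrank_leftRadical_le_one (hC : NoSocleBelow C (e + 1)) (hpq : Separates p q (C (e + 1)))
    {z : A} (hz : z ∈ C 1)
    (hspan : C 1 ≤ leftRadical LinearMap.id (C 1) (leftRadical p (C 1) (C e)) ⊔
      Submodule.span k {z}) :
    finrank k (leftRadical p (C 1) (C e)) ≤ 1 := by
  set K := leftRadical p (C 1) (C e)
  have hpow : z ^ e ∈ C e := by simpa using SetLike.pow_mem_graded e hz
  let f : K →ₗ[k] k := q ∘ₗ LinearMap.mulRight k (z ^ e) ∘ₗ K.subtype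
  have hf : Function.Injective f := by
    refine (injective_iff_map_eq_zero f).2 fun ⟨m, hm⟩ hfm => Subtype.ext ?_
    have hmC : m ∈ C 1 := leftRadical_le _ _ _ hm
    have hmz : m * z ^ e ∈ C (e + 1) := add_comm 1 e ▸ SetLike.mul_mem_graded hmC hpow
    exact hC.eq_zero_of_mul_pow_eq_zero hz hspan (add_comm 1 e).le hmC hm
      (hpq _ hmz ((mem_leftRadical.1 hm).2 _ hpow) hfm)
  simpa using LinearMap.finrank_le_finrank_of_injective hf

theorem leftRadical_eq_bot (hC : NoSocleBelow C (e + 1))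
    (h : leftRadical p (C (e + 1)) (C 1) = ⊥) : leftRadical p (C 1) (C (e + 1)) = ⊥ := by
  refine (Submodule.eq_bot_iff _).2 fun m hm => ?_
  refine hC.eq_zero_of_forall_mul_eq_zero (add_comm 1 e).le (leftRadical_le _ _ _ hm)
    fun t ht => ?_
  rw [← Submodule.mem_bot k, ← h]
  exact mul_mem_leftRadical rfl (add_comm 1 e) hm ht

theorem finrank_annihilator_add_two_le (hC : NoSocleBelow C (e + 2))
    (hpq : Separates p q (C (e + 2))) [FiniteDimensional k (C 1)] [FiniteDimensional k (C (e + 1))]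
    (hlt : finrank k (C (e + 1)) < finrank k (C 1)) :
    finrank k (leftRadical LinearMap.id (C 1) (leftRadical p (C 1) (C (e + 1)))) + 2 ≤
      finrank k (C 1) := by
  by_contra hcon
  obtain ⟨z, hz, hspan⟩ := exists_le_sup_span_singleton
    (leftRadical_le LinearMap.id (C 1) (leftRadical p (C 1) (C (e + 1)))) (by omega)
  have hone := hC.finrank_leftRadical_le_one hpq hz hspan
  have hcomm := finrank_add_finrank_leftRadical_comm p (C 1) (C (e + 1))
  have hbot : leftRadical p (C (e + 1)) (C 1) = ⊥ := Submodule.finrank_eq_zero.1 (by omega)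
  have hC' : NoSocleBelow C (e + 1) := fun i hi => hC (by omega)
  rw [hC'.leftRadical_eq_bot hbot, finrank_bot] at hcomm
  omega

theorem two_le_finrank_leftRadical (hC : NoSocleBelow C (e + 2))
    (hpq : Separates p q (C (e + 2))) [FiniteDimensional k (C 1)] [FiniteDimensional k (C (e + 1))]
    (hlt : finrank k (C (e + 1)) < finrank k (C 1)) :
    2 ≤ finrank k (leftRadical p (C (e + 1)) (C 1)) := by
  have hann := hC.finrank_annihilator_add_two_le hpq hlt
  have hle := hC.finrank_le_finrank_annihilator_add hpq
  omega

theorem finrank_leftRadical_add_finrank_leftRadical_le (hC : NoSocleBelow C (e + 2))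
    (hpq : Separates p q (C (e + 2))) [FiniteDimensional k (C 1)] :
    finrank k (leftRadical q (C 1) (C (e + 1))) +
        finrank k (leftRadical (p + q) (C 1) (C (e + 1))) ≤
      finrank k (leftRadical LinearMap.id (C 1) (leftRadical p (C 1) (C (e + 1)))) := by
  have hdisj : Disjoint (leftRadical q (C 1) (C (e + 1)))
      (leftRadical (p + q) (C 1) (C (e + 1))) :=
    hC.disjoint_leftRadical (add_comm p q ▸ hpq.symm.add_right) (add_comm 1 (e + 1))
  rw [← Submodule.finrank_sup_add_finrank_inf_eq, hdisj.eq_bot, finrank_bot]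
  exact Submodule.finrank_mono (sup_le (hC.leftRadical_le_annihilator hpq)
    (hC.leftRadical_le_annihilator hpq.add_right))

theorem finrank_add_six_le (hC : NoSocleBelow C (e + 2)) (htop : finrank k (C (e + 2)) = 2)
    [FiniteDimensional k (C 1)] [FiniteDimensional k (C (e + 1))]
    (hlt : finrank k (C (e + 1)) < finrank k (C 1)) :
    finrank k (C 1) + 6 ≤ 2 * finrank k (C (e + 1)) := by
  obtain ⟨p, q, hpq⟩ := exists_separates htop
  have hann := hC.finrank_annihilator_add_two_le hpq hlt
  have hsum := hC.finrank_leftRadical_add_finrank_leftRadical_le hpq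
  have hq := hC.two_le_finrank_leftRadical hpq.symm hlt
  have hpq' := hC.two_le_finrank_leftRadical hpq.add_right.symm hlt
  have hcomm_q := finrank_add_finrank_leftRadical_comm q (C 1) (C (e + 1))
  have hcomm_pq := finrank_add_finrank_leftRadical_comm (p + q) (C 1) (C (e + 1))
  omega

end NoSocleBelow

end Level

section Component

open Module

variable {k : Type*} [Field k] {r : ℕ} {I : Ideal (MvPolynomial (Fin r) k)}

theorem mk_mem_component {i : ℕ} {f : MvPolynomial (Fin r) k} (hf : f.IsHomogeneous i) :
    Ideal.Quotient.mk I f ∈ component I i :=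
  ⟨f, hf, rfl⟩

instance (I : Ideal (MvPolynomial (Fin r) k)) : SetLike.GradedMonoid (component I) where
  one_mem := mk_mem_component (isHomogeneous_one _ _)
  mul_mem := by
    rintro i j _ _ ⟨f, hf, rfl⟩ ⟨g, hg, rfl⟩
    exact ⟨f * g, hf.mul hg, map_mul (Ideal.Quotient.mk I) f g⟩

instance (I : Ideal (MvPolynomial (Fin r) k)) (i : ℕ) : FiniteDimensional k (component I i) :=
  Module.Finite.of_fg ((homogeneousSubmodule_fg (Fin r) k i).map _)

theorem mem_socle {u : MvPolynomial (Fin r) k ⧸ I} :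
    u ∈ socle I ↔ ∀ j, u * Ideal.Quotient.mk I (X j) = 0 := by
  simp [socle, Ideal.span, Submodule.mem_annihilator_span]

theorem mul_mk_eq_zero_of_mem_socle {u : MvPolynomial (Fin r) k ⧸ I} (hu : u ∈ socle I) {n : ℕ}
    (hn : n ≠ 0) {g : MvPolynomial (Fin r) k} (hg : g.IsHomogeneous n) :
    u * Ideal.Quotient.mk I g = 0 := by
  have hgX : g ∈ idealOfVars (Fin r) k := by
    rw [← pow_one (idealOfVars _ _), mem_pow_idealOfVars_iff']
    exact fun d hd => hg.coeff_eq_zero (by omega)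
  refine Submodule.mem_annihilator.1 hu _ ?_
  have hmk := Ideal.mem_map_of_mem (Ideal.Quotient.mk I) hgX
  rwa [Ideal.map_span, ← Set.range_comp] at hmk

theorem socleVector_eq_zero_iff {i : ℕ} :
    socleVector I i = 0 ↔ ∀ u ∈ component I i, u ∈ socle I → u = 0 := by
  have := Submodule.finiteDimensional_of_le
    (inf_le_right : (socle I).restrictScalars k ⊓ component I i ≤ component I i)
  rw [socleVector, Submodule.finrank_eq_zero, Submodule.eq_bot_iff]
  exact ⟨fun h u hu hs => h u ⟨hs, hu⟩, fun h u hu => h u hu.2 hu.1⟩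

theorem hVector_eq_zero_iff {i : ℕ} :
    hVector I i = 0 ↔ ∀ f : MvPolynomial (Fin r) k, f.IsHomogeneous i → f ∈ I := by
  rw [hVector, Submodule.finrank_eq_zero, component, ← le_bot_iff, Submodule.map_le_iff_le_comap]
  exact forall₂_congr fun f _ => Ideal.Quotient.eq_zero_iff_mem

theorem hVector_eq_finrank {i : ℕ} {W : Type*} [AddCommGroup W] [Module k W]
    (Ψ : MvPolynomial (Fin r) k →ₗ[k] W)
    (hker : ∀ f : MvPolynomial (Fin r) k, f.IsHomogeneous i → (f ∈ I ↔ Ψ f = 0))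
    (hsurj : ∀ w, ∃ f : MvPolynomial (Fin r) k, f.IsHomogeneous i ∧ Ψ f = w) :
    hVector I i = finrank k W := by
  let π := (Ideal.Quotient.mkₐ k I).toLinearMap.domRestrict (homogeneousSubmodule (Fin r) k i)
  let ψ := Ψ.domRestrict (homogeneousSubmodule (Fin r) k i)
  have hπψ : LinearMap.ker π = LinearMap.ker ψ := by
    ext f
    exact Ideal.Quotient.eq_zero_iff_mem.trans (hker f f.2)
  have hψ : Function.Surjective ψ := fun w =>
    let ⟨f, hf, hfw⟩ := hsurj w
    ⟨⟨f, hf⟩, hfw⟩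
  have hπ : LinearMap.range π = component I i := LinearMap.range_domRestrict _ _
  rw [hVector, ← hπ]
  exact (π.quotKerEquivRange.symm.trans ((Submodule.quotEquivOfEq _ _ hπψ).trans
    (ψ.quotKerEquivOfSurjective hψ))).finrank_eq

theorem hVector_zero (h : I ≠ ⊤) : hVector I 0 = 1 := by
  have := Ideal.Quotient.nontrivial_iff.2 h
  rw [hVector, component, homogeneousSubmodule_zero, Submodule.one_eq_span, Submodule.map_span,
    Set.image_singleton]
  exact finrank_span_singleton (by simp)

theorem hVector_one (h : ∀ f ∈ I, f.IsHomogeneous 1 → f = 0) : hVector I 1 = r := by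
  have hX : LinearIndependent k fun j : Fin r => (Ideal.Quotient.mkₐ k I).toLinearMap (X j) := by
    refine (linearIndependent_X (Fin r) k).map (Submodule.disjoint_def.2 fun f hf hfI => ?_)
    rw [← homogeneousSubmodule_one_eq_span_X] at hf
    exact h f (Ideal.Quotient.eq_zero_iff_mem.1 hfI) hf
  rw [hVector, component, homogeneousSubmodule_one_eq_span_X, Submodule.map_span, ← Set.range_comp]
  exact (finrank_span_eq_card hX).trans (Fintype.card_fin r)

theorem hVector_eq_socleVector {e : ℕ} (h : hVector I (e + 1) = 0) :
    hVector I e = socleVector I e := by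
  have hle : component I e ≤ (socle I).restrictScalars k := by
    rintro _ ⟨f, hf, rfl⟩
    exact mem_socle.2 fun j => Ideal.Quotient.eq_zero_iff_mem.2
      (hVector_eq_zero_iff.1 h (f * X j) (hf.mul (isHomogeneous_X k j)))
  rw [hVector, socleVector, inf_eq_right.2 hle]

theorem finite_of_hVector_eq_zero {e : ℕ} (h : ∀ i, e < i → hVector I i = 0) :
    Module.Finite k (MvPolynomial (Fin r) k ⧸ I) := by
  have htop : ⨆ i : Fin (e + 1), component I i = ⊤ := by
    refine eq_top_iff.2 fun u _ => ?_
    obtain ⟨f, rfl⟩ := Ideal.Quotient.mk_surjective u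
    rw [← sum_homogeneousComponent f, map_sum]
    refine Submodule.sum_mem _ fun n _ => ?_
    have hn := homogeneousComponent_isHomogeneous n f
    rcases lt_or_ge e n with hen | hne
    · rw [Ideal.Quotient.eq_zero_iff_mem.2 (hVector_eq_zero_iff.1 (h n hen) _ hn)]
      exact zero_mem _
    · exact Submodule.mem_iSup_of_mem ⟨n, Nat.lt_succ_of_le hne⟩ (mk_mem_component hn)
  exact ⟨htop ▸ Submodule.fg_iSup _ fun i => (homogeneousSubmodule_fg (Fin r) k i).map _⟩

namespace IsLevelAlgebra

variable {e t : ℕ}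

theorem hVector_one (h : IsLevelAlgebra I e t) : hVector I 1 = r :=
  LevelAlgebra.hVector_one h.no_linear_form

theorem hVector_socleDegree (h : IsLevelAlgebra I e t) : hVector I e = t := by
  rw [← h.socle_top]
  refine hVector_eq_socleVector (Nat.eq_zero_of_not_pos fun hpos => ?_)
  exact Nat.not_succ_le_self e (h.socle_degree.2 hpos)

theorem noSocleBelow (h : IsLevelAlgebra I e t) : NoSocleBelow (component I) e :=
  fun i hi u hu hl => socleVector_eq_zero_iff.1 (h.socle_below i hi) u hu
    (mem_socle.2 fun j => hl _ (mk_mem_component (isHomogeneous_X k j)))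

theorem hVector_le (h : IsLevelAlgebra I (e + 1) t) : hVector I e ≤ t * r := by
  have := h.noSocleBelow.finrank_le_mul e.lt_succ_self
  rwa [← hVector, ← hVector, ← hVector, h.hVector_one, h.hVector_socleDegree, mul_comm] at this

theorem add_six_le (h : IsLevelAlgebra I (e + 2) 2) (hlt : hVector I (e + 1) < r) :
    r + 6 ≤ 2 * hVector I (e + 1) := by
  have := h.noSocleBelow.finrank_add_six_le h.hVector_socleDegree (hlt.trans_eq h.hVector_one.symm)
  rwa [← hVector, ← hVector, h.hVector_one] at this

end IsLevelAlgebra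

end Component

section Apolar

section Semiring

variable {k A T : Type*} [CommSemiring k] [CommSemiring A] [Algebra k A] [AddCommMonoid T]
  [Module k T]

/-- The largest ideal contained in the kernel of a linear map on an algebra. For the coefficient
functionals of the polynomial ring this is the annihilator of a Macaulay inverse system. -/
def apolarIdeal (Φ : A →ₗ[k] T) : Ideal A where
  carrier := {f | ∀ g, Φ (f * g) = 0}
  add_mem' ha hb g := by rw [add_mul, map_add, ha g, hb g, add_zero]
  zero_mem' g := by rw [zero_mul, map_zero]
  smul_mem' c f hf g := by rw [smul_eq_mul, mul_comm c f, mul_assoc, hf]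

theorem apply_eq_zero_of_mem_apolarIdeal {Φ : A →ₗ[k] T} {f : A} (hf : f ∈ apolarIdeal Φ) :
    Φ f = 0 := by
  simpa using hf 1

/-- A linear map on a graded algebra that vanishes on all pieces except possibly the one of
degree `e`. -/
def IsConcentrated (𝒜 : ℕ → Submodule k A) (Φ : A →ₗ[k] T) (e : ℕ) : Prop :=
  ∀ ⦃n : ℕ⦄ ⦃f : A⦄, f ∈ 𝒜 n → n ≠ e → Φ f = 0

namespace IsConcentrated

variable {𝒜 : ℕ → Submodule k A} [GradedAlgebra 𝒜] {Φ : A →ₗ[k] T} {e : ℕ}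

theorem apply_eq (hΦ : IsConcentrated 𝒜 Φ e) (f : A) : Φ f = Φ (DirectSum.decompose 𝒜 f e) := by
  classical
  conv_lhs => rw [← DirectSum.sum_support_decompose 𝒜 f, map_sum]
  refine Finset.sum_eq_single e (fun n _ hn => hΦ (SetLike.coe_mem _) hn) fun he => ?_
  rw [DFinsupp.notMem_support_iff.1 he, ZeroMemClass.coe_zero, map_zero]

theorem mem_apolarIdeal_iff (hΦ : IsConcentrated 𝒜 Φ e) {i j : ℕ} (hij : i + j = e) {f : A}
    (hf : f ∈ 𝒜 i) : f ∈ apolarIdeal Φ ↔ ∀ g ∈ 𝒜 j, Φ (f * g) = 0 := by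
  refine ⟨fun h g _ => h g, fun h g => ?_⟩
  rw [hΦ.apply_eq, ← hij, DirectSum.coe_decompose_mul_add_of_left_mem 𝒜 hf]
  exact h _ (SetLike.coe_mem _)

theorem mem_apolarIdeal_of_lt (hΦ : IsConcentrated 𝒜 Φ e) {i : ℕ} (hi : e < i) {f : A}
    (hf : f ∈ 𝒜 i) : f ∈ apolarIdeal Φ := fun g => by
  rw [hΦ.apply_eq, DirectSum.coe_decompose_mul_of_left_mem_of_not_le 𝒜 hf hi.not_ge, map_zero]

theorem isHomogeneous_apolarIdeal (hΦ : IsConcentrated 𝒜 Φ e) :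
    (apolarIdeal Φ).IsHomogeneous 𝒜 := by
  intro i f hf
  rcases lt_or_ge e i with hi | hi
  · exact hΦ.mem_apolarIdeal_of_lt hi (SetLike.coe_mem _)
  obtain ⟨j, rfl⟩ := Nat.exists_eq_add_of_le hi
  refine (hΦ.mem_apolarIdeal_iff rfl (SetLike.coe_mem _)).2 fun g hg => ?_
  rw [← DirectSum.coe_decompose_mul_add_of_right_mem 𝒜 hg, ← hΦ.apply_eq]
  exact hf g

end IsConcentrated

end Semiring

attribute [local instance] MvPolynomial.gradedAlgebra

variable {k : Type*} [Field k] {r : ℕ} {T : Type*} [AddCommGroup T] [Module k T]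
  {Φ : MvPolynomial (Fin r) k →ₗ[k] T} {e : ℕ}

namespace IsConcentrated

theorem hVector_eq_zero (hΦ : IsConcentrated (homogeneousSubmodule (Fin r) k) Φ e) {i : ℕ}
    (hi : e < i) : hVector (apolarIdeal Φ) i = 0 :=
  hVector_eq_zero_iff.2 fun _ hf => hΦ.mem_apolarIdeal_of_lt hi hf

theorem hVector_top (hΦ : IsConcentrated (homogeneousSubmodule (Fin r) k) Φ e)
    (hsurj : Function.Surjective Φ) : hVector (apolarIdeal Φ) e = Module.finrank k T := by
  refine hVector_eq_finrank Φ (fun f hf => ⟨apply_eq_zero_of_mem_apolarIdeal, fun h => ?_⟩)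
    fun w => ?_
  · refine (hΦ.mem_apolarIdeal_iff (add_zero e) hf).2 fun g hg => ?_
    rw [homogeneousSubmodule_zero] at hg
    obtain ⟨c, rfl⟩ := Submodule.mem_one.1 hg
    rw [← Algebra.commutes, ← Algebra.smul_def, map_smul, h, smul_zero]
  · obtain ⟨f, rfl⟩ := hsurj w
    let f_e := DirectSum.decompose (homogeneousSubmodule (Fin r) k) f e
    exact ⟨f_e, f_e.2, (hΦ.apply_eq f).symm⟩

theorem socleVector_eq_zero (hΦ : IsConcentrated (homogeneousSubmodule (Fin r) k) Φ e) {i : ℕ}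
    (hi : i < e) : socleVector (apolarIdeal Φ) i = 0 := by
  rw [socleVector_eq_zero_iff]
  rintro _ ⟨f, hf, rfl⟩ hs
  refine Ideal.Quotient.eq_zero_iff_mem.2 ?_
  refine (hΦ.mem_apolarIdeal_iff (Nat.add_sub_of_le hi.le) hf).2 fun g hg => ?_
  refine apply_eq_zero_of_mem_apolarIdeal (Ideal.Quotient.eq_zero_iff_mem.1 ?_)
  rw [map_mul]
  exact mul_mk_eq_zero_of_mem_socle hs (Nat.sub_ne_zero_of_lt hi) hg

theorem isLevelAlgebra [Nontrivial T] [FiniteDimensional k T]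
    (hΦ : IsConcentrated (homogeneousSubmodule (Fin r) k) Φ e) (hsurj : Function.Surjective Φ)
    (hlin : ∀ f ∈ apolarIdeal Φ, f.IsHomogeneous 1 → f = 0) :
    IsLevelAlgebra (apolarIdeal Φ) e (Module.finrank k T) where
  homogeneous := hΦ.isHomogeneous_apolarIdeal
  artinian :=
    have := finite_of_hVector_eq_zero fun _ => hΦ.hVector_eq_zero
    IsArtinianRing.of_finite k _
  no_linear_form := hlin
  socle_degree := ⟨Module.finrank_pos.trans_eq (hΦ.hVector_top hsurj).symm, fun _ hi =>
    not_lt.1 fun hlt => Nat.ne_of_gt hi (hΦ.hVector_eq_zero hlt)⟩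
  socle_below _ hi := hΦ.socleVector_eq_zero hi
  socle_top := by
    rw [← hVector_eq_socleVector (hΦ.hVector_eq_zero e.lt_succ_self), hΦ.hVector_top hsurj]

end IsConcentrated

end Apolar

section Construction

attribute [local instance] MvPolynomial.gradedAlgebra

section Semiring

variable {k σ : Type*} [CommSemiring k]

theorem eq_zero_of_isHomogeneous_one {f : MvPolynomial σ k} (hf : f.IsHomogeneous 1)
    (h : ∀ j, coeff (Finsupp.single j 1) f = 0) : f = 0 := by
  ext d
  by_contra hd
  obtain ⟨j, rfl⟩ : d ∈ Set.range fun j : σ => Finsupp.single j 1 := by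
    rw [Finsupp.range_single_one]
    exact not_imp_comm.1 hf.coeff_eq_zero hd
  exact hd (h j)

theorem IsConcentrated.mem_apolarIdeal_iff_forall_X {T : Type*} [AddCommMonoid T] [Module k T]
    {Φ : MvPolynomial σ k →ₗ[k] T} {d : ℕ}
    (hΦ : IsConcentrated (homogeneousSubmodule σ k) Φ (d + 1)) {f : MvPolynomial σ k}
    (hf : f.IsHomogeneous d) : f ∈ apolarIdeal Φ ↔ ∀ j, Φ (X j * f) = 0 := by
  rw [hΦ.mem_apolarIdeal_iff rfl hf, homogeneousSubmodule_one_eq_span_X]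
  change Submodule.span k (Set.range X) ≤ LinearMap.ker (Φ ∘ₗ LinearMap.mulLeft k f) ↔ _
  simp [Submodule.span_le, Set.range_subset_iff, mul_comm]

/-- The exponent of `x_i ^ d * x_{τ i}`. -/
noncomputable def edgeExponent (τ : σ → σ) (d : ℕ) (i : σ) : σ →₀ ℕ :=
  Finsupp.single i d + Finsupp.single (τ i) 1

theorem degree_edgeExponent (τ : σ → σ) (d : ℕ) (i : σ) : (edgeExponent τ d i).degree = d + 1 := by
  simp [edgeExponent]

theorem single_ne_edgeExponent {τ : σ → σ} (hτ : ∀ i, τ i ≠ i) {d : ℕ} (hd : d ≠ 0) (i j : σ)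
    (c : ℕ) : Finsupp.single i c ≠ edgeExponent τ d j := by
  classical
  intro h
  have hj := DFunLike.congr_fun h j
  have hτj := DFunLike.congr_fun h (τ j)
  simp only [edgeExponent, Finsupp.add_apply, Finsupp.single_apply] at hj hτj
  grind

theorem edgeExponent_injective {τ : σ → σ} {d : ℕ} (h : d ≠ 0 ∨ ∀ i, τ (τ i) ≠ i) :
    Function.Injective (edgeExponent τ (d + 1)) := by
  classical
  intro i j hij
  have hi := DFunLike.congr_fun hij i
  have hj := DFunLike.congr_fun hij j
  simp only [edgeExponent, Finsupp.add_apply, Finsupp.single_apply] at hi hj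
  grind

section Forms

variable [Fintype σ] (k) (τ : σ → σ) (S : Finset σ) (o : σ) (d : ℕ)

/-- The functional dual to `∑ i, x_i ^ e`: the sum of the coefficients of all `x_i ^ e`. -/
noncomputable def powerForm (σ : Type*) [Fintype σ] (e : ℕ) : MvPolynomial σ k →ₗ[k] k :=
  ∑ i, lcoeff k (Finsupp.single i e)

/-- The functional of degree `d + 1` dual to `x_o ^ (d + 1) + ∑ i ∈ S, x_i ^ d * x_{τ i}`. -/
noncomputable def chainForm : MvPolynomial σ k →ₗ[k] k :=
  lcoeff k (Finsupp.single o (d + 1)) + ∑ i ∈ S, lcoeff k (edgeExponent τ d i)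

/-- The pair of functionals of degree `d + 1` that generates the inverse system of the example. -/
noncomputable def pencil : MvPolynomial σ k →ₗ[k] k × k :=
  (powerForm k σ (d + 1)).prod (chainForm k τ S o d)

end Forms

variable {τ : σ → σ} {S : Finset σ} {o : σ}

theorem chainForm_apply (d : ℕ) (f : MvPolynomial σ k) :
    chainForm k τ S o d f =
      coeff (Finsupp.single o (d + 1)) f + ∑ i ∈ S, coeff (edgeExponent τ d i) f := by
  simp [chainForm]

theorem coeff_edgeExponent_X_mul_of_ne {d : ℕ} {i j : σ} (hij : i ≠ j) {f : MvPolynomial σ k}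
    (hf : coeff (Finsupp.single i d) f = 0) : coeff (edgeExponent τ d i) (X j * f) = 0 := by
  classical
  obtain rfl | hj := eq_or_ne (τ i) j
  · rw [edgeExponent, add_comm, coeff_X_mul, hf]
  · rw [coeff_X_mul', if_neg (by simp [edgeExponent, hij, hj])]

theorem chainForm_X_mul [DecidableEq σ] {d : ℕ} (j : σ) {f : MvPolynomial σ k}
    (hf : ∀ i, coeff (Finsupp.single i (d + 1)) f = 0) :
    chainForm k τ S o (d + 1) (X j * f) = if j ∈ S then coeff (edgeExponent τ d j) f else 0 := by
  have hpure : coeff (Finsupp.single o (d + 1 + 1)) (X j * f) = 0 := by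
    obtain rfl | hj := eq_or_ne o j
    · rw [add_comm, Finsupp.single_add, coeff_X_mul, hf]
    · rw [coeff_X_mul', if_neg (by simp [hj])]
  have hedge : ∀ i, coeff (edgeExponent τ (d + 1) i) (X j * f) =
      if i = j then coeff (edgeExponent τ d j) f else 0 := by
    intro i
    split_ifs with hij
    · rw [hij, edgeExponent, add_comm d, Finsupp.single_add, add_assoc, coeff_X_mul, edgeExponent]
    · exact coeff_edgeExponent_X_mul_of_ne hij (hf i)
  rw [chainForm_apply, hpure, zero_add, Finset.sum_congr rfl fun i _ => hedge i,
    Finset.sum_ite_eq']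

variable [Fintype σ]

theorem powerForm_apply (e : ℕ) (f : MvPolynomial σ k) :
    powerForm k σ e f = ∑ i, coeff (Finsupp.single i e) f := by
  simp [powerForm]

theorem isConcentrated_pencil (d : ℕ) :
    IsConcentrated (homogeneousSubmodule σ k) (pencil k τ S o d) (d + 1) := by
  intro n f hf hn
  have hcoeff : ∀ m : σ →₀ ℕ, m.degree = d + 1 → coeff m f = 0 := fun m hm =>
    IsHomogeneous.coeff_eq_zero hf (hm.trans_ne hn.symm)
  refine Prod.ext ((powerForm_apply _ f).trans ?_) ((chainForm_apply d f).trans ?_)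
  · exact Finset.sum_eq_zero fun i _ => hcoeff _ (Finsupp.degree_single i _)
  · rw [hcoeff _ (Finsupp.degree_single o _), zero_add]
    exact Finset.sum_eq_zero fun i _ => hcoeff _ (degree_edgeExponent τ d i)

theorem powerForm_X_mul (e : ℕ) (j : σ) (f : MvPolynomial σ k) :
    powerForm k σ (e + 1) (X j * f) = coeff (Finsupp.single j e) f := by
  classical
  rw [powerForm_apply, Finset.sum_eq_single j]
  · rw [add_comm, Finsupp.single_add, coeff_X_mul]
  · intro i _ hij
    rw [coeff_X_mul', if_neg (by simp [hij])]
  · simp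

theorem eq_zero_of_mem_apolarIdeal_pencil {d : ℕ} {f : MvPolynomial σ k}
    (hf : f ∈ apolarIdeal (pencil k τ S o (d + 1))) (hf1 : f.IsHomogeneous 1) : f = 0 := by
  refine eq_zero_of_isHomogeneous_one hf1 fun j => ?_
  have h : powerForm k σ (d + 1 + 1) (f * (X j * X j ^ d)) = 0 :=
    congrArg Prod.fst (hf (X j * X j ^ d))
  rwa [mul_left_comm, powerForm_X_mul, X_pow_eq_monomial, Finsupp.single_add,
    add_comm (Finsupp.single j d), coeff_mul_monomial, mul_one] at h

theorem mem_apolarIdeal_pencil_iff {d : ℕ} {f : MvPolynomial σ k} (hf : f.IsHomogeneous (d + 1)) :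
    f ∈ apolarIdeal (pencil k τ S o (d + 1)) ↔
      (∀ j, coeff (Finsupp.single j (d + 1)) f = 0) ∧
        ∀ j ∈ S, coeff (edgeExponent τ d j) f = 0 := by
  classical
  have hX : ∀ j, pencil k τ S o (d + 1) (X j * f) =
      (coeff (Finsupp.single j (d + 1)) f, chainForm k τ S o (d + 1) (X j * f)) := fun j =>
    Prod.ext (powerForm_X_mul (d + 1) j f) rfl
  rw [(isConcentrated_pencil (d + 1)).mem_apolarIdeal_iff_forall_X hf]
  simp only [hX, Prod.mk_eq_zero, forall_and]
  refine and_congr_right fun hpure => forall_congr' fun j => ?_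
  rw [chainForm_X_mul j hpure, ite_eq_right_iff]

theorem pencil_monomial_single [DecidableEq σ] (hτ : ∀ i, τ i ≠ i) {d : ℕ} (hd : d ≠ 0) (i : σ) :
    pencil k τ S o d (monomial (Finsupp.single i (d + 1)) 1) = (1, if i = o then 1 else 0) := by
  refine Prod.ext ((powerForm_apply _ _).trans ?_) ((chainForm_apply _ _).trans ?_)
  · simp [coeff_monomial, Finsupp.single_left_inj, -Finsupp.single_add]
  · simp [coeff_monomial, Finsupp.single_left_inj, single_ne_edgeExponent hτ hd,
      -Finsupp.single_add]

end Semiring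

theorem surjective_pencil {k σ : Type*} [CommRing k] [Fintype σ] [Nontrivial σ] {τ : σ → σ}
    (hτ : ∀ i, τ i ≠ i) {d : ℕ} (hd : d ≠ 0) (S : Finset σ) (o : σ) :
    Function.Surjective (pencil k τ S o d) := by
  classical
  obtain ⟨i, hi⟩ := exists_ne o
  rintro ⟨a, b⟩
  refine ⟨b • monomial (Finsupp.single o (d + 1)) 1 +
    (a - b) • monomial (Finsupp.single i (d + 1)) 1, ?_⟩
  simp [-Finsupp.single_add, pencil_monomial_single hτ hd, hi]

variable {k : Type*} [Field k] {r : ℕ}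

theorem hVector_eq_card {I : Ideal (MvPolynomial (Fin r) k)} {ι : Type*} [Fintype ι]
    {m : ι → Fin r →₀ ℕ} (hm : Function.Injective m) {d : ℕ} (hd : ∀ i, (m i).degree = d)
    (hI : ∀ f : MvPolynomial (Fin r) k, f.IsHomogeneous d → (f ∈ I ↔ ∀ i, coeff (m i) f = 0)) :
    hVector I d = Fintype.card ι := by
  classical
  rw [← Module.finrank_fintype_fun_eq_card k]
  refine hVector_eq_finrank (LinearMap.pi fun i => lcoeff k (m i))
    (fun f hf => (hI f hf).trans funext_iff.symm) fun w => ⟨∑ i, monomial (m i) (w i), ?_, ?_⟩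
  · exact IsHomogeneous.sum _ _ _ fun i _ => isHomogeneous_monomial _ (hd i)
  · ext j
    simp [coeff_monomial, hm.eq_iff]

theorem hVector_apolarIdeal_pencil {τ : Fin r → Fin r} (hτ : ∀ i, τ i ≠ i) {S : Finset (Fin r)}
    {d : ℕ} (hS : Set.InjOn (edgeExponent τ (d + 1)) S) (o : Fin r) :
    hVector (apolarIdeal (pencil k τ S o (d + 2))) (d + 2) = r + S.card := by
  have hinj : Function.Injective
      (Sum.elim (fun i => Finsupp.single i (d + 2)) fun i : S => edgeExponent τ (d + 1) i) :=
    (Finsupp.single_left_injective (by omega)).sumElim hS.injective fun i j =>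
      single_ne_edgeExponent hτ (by omega) i j _
  rw [hVector_eq_card hinj]
  · simp
  · exact Sum.rec (fun i => Finsupp.degree_single i _) fun i => degree_edgeExponent τ _ i
  · intro f hf
    rw [mem_apolarIdeal_pencil_iff hf, Sum.forall, Subtype.forall]
    rfl

theorem isLevelAlgebra_apolarIdeal_pencil [Nontrivial (Fin r)] {τ : Fin r → Fin r}
    (hτ : ∀ i, τ i ≠ i) (S : Finset (Fin r)) (o : Fin r) (d : ℕ) :
    IsLevelAlgebra (apolarIdeal (pencil k τ S o (d + 1))) (d + 2) 2 := by
  have hT : Module.finrank k (k × k) = 2 := by simp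
  have hlevel := (isConcentrated_pencil (k := k) (d + 1)).isLevelAlgebra
    (surjective_pencil hτ d.succ_ne_zero S o) fun _ => eq_zero_of_mem_apolarIdeal_pencil
  rwa [hT] at hlevel

theorem exists_injOn_edgeExponent_add_one {n d J : ℕ} (hJ : J ≤ n + 2)
    (h : ¬(n = 0 ∧ d = 0 ∧ J = 2)) :
    ∃ S : Finset (Fin (n + 2)), S.card = J ∧
      Set.InjOn (edgeExponent (fun i : Fin (n + 2) => i + 1) (d + 1)) S := by
  obtain ⟨S, -, hS⟩ := Finset.exists_subset_card_eq (s := (Finset.univ : Finset (Fin (n + 2))))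
    (n := J) (by simpa)
  refine ⟨S, hS, ?_⟩
  by_cases hnd : n = 0 ∧ d = 0
  · have hS1 : S.card ≤ 1 := by omega
    exact (Finset.card_le_one_iff_subsingleton.1 hS1).injOn _
  · refine (edgeExponent_injective ?_).injOn
    rw [or_iff_not_imp_left]
    intro hd i hi
    have hmod : 2 % (n + 2) = 0 := by
      simpa [add_assoc, Fin.ext_iff, Fin.val_add] using (add_assoc i 1 1 ▸ hi : i + (1 + 1) = i)
    rw [Nat.mod_eq_of_lt (by omega)] at hmod
    omega

theorem exists_isLevelHVector (k : Type*) [Field k] {n d J : ℕ} (hJ : J ≤ n + 2)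
    (hne : ¬(n = 0 ∧ d = 0 ∧ J = 2)) :
    ∃ h : ℕ → ℕ, IsLevelHVector k (n + 2) (d + 3) 2 h ∧
      h 0 = 1 ∧ h 1 = n + 2 ∧ h (d + 2) = n + 2 + J ∧ h (d + 3) = 2 := by
  obtain ⟨S, rfl, hS⟩ := exists_injOn_edgeExponent_add_one hJ hne
  have hτ : ∀ i : Fin (n + 2), i + 1 ≠ i := fun i => by simp
  have hA := isLevelAlgebra_apolarIdeal_pencil (k := k) hτ S 0 (d + 1)
  refine ⟨_, ⟨_, hA, rfl⟩, hVector_zero fun htop => ?_, hA.hVector_one,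
    hVector_apolarIdeal_pencil hτ hS 0, hA.hVector_socleDegree⟩
  exact X_ne_zero 0 (hA.no_linear_form (X 0) (htop ▸ Submodule.mem_top) (isHomogeneous_X k 0))

end Construction

end LevelAlgebra

theorem theorem3p3_general (k : Type*) [Field k] (r : ℕ) :
    (∀ (e t : ℕ) (h : ℕ → ℕ), 1 ≤ e → LevelAlgebra.IsLevelHVector k r e t h →
      h (e - 1) ≤ t * r) ∧
    (∀ e a : ℕ, 2 ≤ r → 3 ≤ e → r ≤ a → a ≤ 2 * r → ¬(r = 2 ∧ e = 3 ∧ a = 4) →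
      ∃ h : ℕ → ℕ, LevelAlgebra.IsLevelHVector k r e 2 h ∧
        h 0 = 1 ∧ h 1 = r ∧ h (e - 1) = a ∧ h e = 2) ∧
    (∀ (e : ℕ) (h : ℕ → ℕ), 2 ≤ e → LevelAlgebra.IsLevelHVector k r e 2 h →
      h (e - 1) < r → r + 6 ≤ 2 * h (e - 1)) := by
  refine ⟨?_, ?_, ?_⟩
  · rintro e t _ he ⟨I, hI, rfl⟩
    obtain ⟨e, rfl⟩ := Nat.exists_eq_add_of_le' he
    exact hI.hVector_le
  · intro e a hr he ha ha' hne
    obtain ⟨n, rfl⟩ := Nat.exists_eq_add_of_le' hr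
    obtain ⟨d, rfl⟩ := Nat.exists_eq_add_of_le' he
    obtain ⟨J, rfl⟩ := Nat.exists_eq_add_of_le ha
    exact LevelAlgebra.exists_isLevelHVector k (by omega) (by omega)
  · rintro e _ he ⟨I, hI, rfl⟩
    obtain ⟨e, rfl⟩ := Nat.exists_eq_add_of_le' he
    exact hI.add_six_le

theorem theorem3p3 (k : Type*) [Field k] [CharZero k] (r : ℕ) :
    (∀ (e : ℕ) (h : ℕ → ℕ), 2 ≤ e → LevelAlgebra.IsLevelHVector k r e 2 h →
      h (e - 1) ≤ 2 * r) ∧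
    (∀ e a : ℕ, 2 ≤ r → 3 ≤ e → r ≤ a → a ≤ 2 * r → ¬(r = 2 ∧ e = 3 ∧ a = 4) →
      ∃ h : ℕ → ℕ, LevelAlgebra.IsLevelHVector k r e 2 h ∧
        h 0 = 1 ∧ h 1 = r ∧ h (e - 1) = a ∧ h e = 2) ∧
    (r ≤ 7 → ∀ (e : ℕ) (h : ℕ → ℕ), 2 ≤ e → LevelAlgebra.IsLevelHVector k r e 2 h →
      r ≤ h (e - 1)) :=
  have ⟨h_le, h_exists, h_six⟩ := theorem3p3_general k r
  ⟨fun e h he => h_le e 2 h (by omega), h_exists, fun hr e h he hh => by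
    have := h_six e h he hh; omega⟩
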